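/- Let $(M,g)$ be a smooth Riemannian $3$-manifold (not necessarily closed) with Levi-Civita connection $\nabla$, and let $X$ be a complete geodesic vector field on $M$, i.e. a smooth unit vector field with $\nabla_X X=0$ whose integral curves exist for all time. Let $\beta_p\colon X_p^\perp\to X_p^\perp$, $v\mapsto\nabla_vX$, let $\lambda,\mu$ denote the two complex eigenvalues of $\beta_p$ (with multiplicity), let $\mathrm{Ric}(X_p)$ be the Ricci curvature in direction $X_p$, i.e. the trace of $v\mapsto R(v,X_p)X_p$, and let $\alpha=g(X,\cdot)$. Say that $X^\perp=\ker\alpha$ is contact at $p$ if $(\alpha\wedge d\alpha)_p\neq0$, and that $X$ induces a contact structure if $X^\perp$ is contact at every point. (a) Assume that $\mathrm{Ric}(X)+\frac{|\lambda-\mu|^2}{2}\ge 0$ everywhere on $M$. If $X^\perp$ is not contact at $p\in M$, then either $\mathrm{Ric}(X_p)<0$, or $\mathrm{Ric}(X_p)=0$ and $\beta_p=0$. (b) Consequently, if $\mathrm{Ric}(X)\ge 0$ everywhere and $\beta_p\neq 0$ at every point $p$ with $\mathrm{Ric}(X_p)=0$, then $X$ induces a contact structure. -/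

import Mathlib

open Bundle FiberBundle VectorField
open scoped Manifold ContDiff

noncomputable section

namespace GeodesicField

variable {E : Type*} [NormedAddCommGroup E] [NormedSpace ℝ E]
  {H : Type*} [TopologicalSpace H] {I : ModelWithCorners ℝ E H}
  {M : Type*} [TopologicalSpace M] [ChartedSpace H M]
  [RiemannianBundle (fun x : M => TangentSpace I x)]

section Sharp

variable [FiniteDimensional ℝ E]

instance instFiniteDimensionalTangentSpace (x : M) : FiniteDimensional ℝ (TangentSpace I x) :=
  inferInstanceAs (FiniteDimensional ℝ E)

instance instCompleteSpaceTangentSpace (x : M) : CompleteSpace (TangentSpace I x) :=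
  FiniteDimensional.complete ℝ _

/-- The vector `u` representing a continuous linear functional `φ` on `T_x M`, i.e. with
`⟨u, w⟩ = φ w` for all `w`. -/
def sharp (x : M) : (TangentSpace I x →L[ℝ] ℝ) →L[ℝ] TangentSpace I x :=
  LinearMap.toContinuousLinearMap
    ((InnerProductSpace.toDual ℝ (TangentSpace I x)).symm.toLinearEquiv.toLinearMap)

theorem inner_sharp (x : M) (φ : TangentSpace I x →L[ℝ] ℝ) (w : TangentSpace I x) :
    inner ℝ (sharp x φ) w = φ w :=
  InnerProductSpace.toDual_symm_apply

end Sharp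

/-- The expression on the right-hand side of the Koszul formula, i.e. the common value of
`2 ⟨∇_V Y, W⟩` for the Levi-Civita connection. -/
def koszul (Y V W : Π x : M, TangentSpace I x) (x : M) : ℝ :=
  d% (fun y : M => inner ℝ (Y y) (W y)) x (V x)
    + d% (fun y : M => inner ℝ (V y) (W y)) x (Y x)
    - d% (fun y : M => inner ℝ (V y) (Y y)) x (W x)
    + inner ℝ (mlieBracket I V Y x) (W x)
    - inner ℝ (mlieBracket I V W x) (Y x)
    - inner ℝ (mlieBracket I Y W x) (V x)

variable [IsManifold I ∞ M]
  [IsContMDiffRiemannianBundle I ∞ E (fun x : M => TangentSpace I x)]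

theorem mdifferentiableAt_inner {Y W : Π x : M, TangentSpace I x} {x : M}
    (hY : MDiffAt (T% Y) x) (hW : MDiffAt (T% W) x) :
    MDiffAt (fun y : M => inner ℝ (Y y) (W y)) x :=
  MDifferentiableAt.inner_bundle (E := fun x : M => TangentSpace I x) (b := fun x => x) hY hW

variable [FiniteDimensional ℝ E]

theorem koszul_tensorial_right (Y V : Π x : M, TangentSpace I x) (x : M)
    (hY : MDiffAt (T% Y) x) (hV : MDiffAt (T% V) x) :
    TensorialAt I E (fun W => koszul Y V W x) x where
  smul {f W} hf hW := by
    have h1 := mvfderiv_fun_mul hf (mdifferentiableAt_inner hY hW)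
    have h2 := mvfderiv_fun_mul hf (mdifferentiableAt_inner hV hW)
    simp [koszul, h1, h2, inner_smul_right, inner_smul_left, inner_add_left,
      mlieBracket_smul_right hf hW]
    rw [real_inner_comm (W x) (Y x), real_inner_comm (W x) (V x)]
    ring
  add {W W'} hW hW' := by
    have h1 := mvfderiv_fun_add (mdifferentiableAt_inner hY hW) (mdifferentiableAt_inner hY hW')
    have h2 := mvfderiv_fun_add (mdifferentiableAt_inner hV hW) (mdifferentiableAt_inner hV hW')
    simp [koszul, h1, h2, inner_add_right, inner_add_left, mlieBracket_add_right hW hW']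
    ring

theorem koszul_tensorial_left (Y W : Π x : M, TangentSpace I x) (x : M)
    (hY : MDiffAt (T% Y) x) (hW : MDiffAt (T% W) x) :
    TensorialAt I E (fun V => koszul Y V W x) x where
  smul {f V} hf hV := by
    have h1 := mvfderiv_fun_mul hf (mdifferentiableAt_inner hV hY)
    have h2 := mvfderiv_fun_mul hf (mdifferentiableAt_inner hV hW)
    simp [koszul, h1, h2, inner_smul_right, inner_smul_left, inner_add_left,
      mlieBracket_smul_left hf hV]
    ring
  add {V V'} hV hV' := by
    have h1 := mvfderiv_fun_add (mdifferentiableAt_inner hV hY) (mdifferentiableAt_inner hV' hY)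
    have h2 := mvfderiv_fun_add (mdifferentiableAt_inner hV hW) (mdifferentiableAt_inner hV' hW)
    simp [koszul, h1, h2, inner_add_right, inner_add_left, mlieBracket_add_left hV hV']
    ring

theorem koszul_add {Y Y' V W : Π x : M, TangentSpace I x} {x : M}
    (hY : MDiffAt (T% Y) x) (hY' : MDiffAt (T% Y') x) (hV : MDiffAt (T% V) x)
    (hW : MDiffAt (T% W) x) :
    koszul (Y + Y') V W x = koszul Y V W x + koszul Y' V W x := by
  have h1 := mvfderiv_fun_add (mdifferentiableAt_inner hY hW) (mdifferentiableAt_inner hY' hW)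
  have h2 := mvfderiv_fun_add (mdifferentiableAt_inner hV hY) (mdifferentiableAt_inner hV hY')
  simp [koszul, h1, h2, inner_add_right, inner_add_left, mlieBracket_add_right hY hY',
    mlieBracket_add_left hY hY']
  ring

theorem koszul_smul {f : M → ℝ} {Y V W : Π x : M, TangentSpace I x} {x : M}
    (hf : MDiffAt f x) (hY : MDiffAt (T% Y) x) (hV : MDiffAt (T% V) x)
    (hW : MDiffAt (T% W) x) :
    koszul (f • Y) V W x =
      f x * koszul Y V W x + 2 * (d% f x (V x) * inner ℝ (Y x) (W x)) := by
  have h1 := mvfderiv_fun_mul hf (mdifferentiableAt_inner hY hW)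
  have h2 := mvfderiv_fun_mul hf (mdifferentiableAt_inner hV hY)
  simp [koszul, h1, h2, inner_smul_right, inner_smul_left, inner_add_left,
    mlieBracket_smul_right hf hY, mlieBracket_smul_left hf hY]
  rw [real_inner_comm (Y x) (V x)]
  ring

open Classical in
/-- The covariant derivative of the vector field `Y` for the Levi-Civita connection, defined by
`⟨∇_V Y, W⟩ = 1/2 · koszul Y V W` (and set to `0` at points where `Y` is not differentiable). -/
def leviCivitaFun (Y : Π x : M, TangentSpace I x) (x : M) :
    TangentSpace I x →L[ℝ] TangentSpace I x :=
  if hY : MDiffAt (T% Y) x then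
    (1 / 2 : ℝ) • (sharp x).comp (TensorialAt.mkHom₂ (F := E) (F' := E) (koszul Y · · x) x
      (fun W hW => koszul_tensorial_left Y W x hY hW)
      (fun V hV => koszul_tensorial_right Y V x hY hV))
  else 0

theorem two_mul_inner_leviCivitaFun {Y V W : Π x : M, TangentSpace I x} {x : M}
    (hY : MDiffAt (T% Y) x) (hV : MDiffAt (T% V) x) (hW : MDiffAt (T% W) x) :
    2 * inner ℝ (leviCivitaFun Y x (V x)) (W x) = koszul Y V W x := by
  have := TensorialAt.mkHom₂_apply (F := E) (F' := E) (Φ := (koszul Y · · x))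
      (fun W hW => koszul_tensorial_left Y W x hY hW)
      (fun V hV => koszul_tensorial_right Y V x hY hV) hV hW
  rw [← this]
  simp [leviCivitaFun, hY, inner_smul_left, inner_sharp]

theorem inner_leviCivitaFun {Y : Π x : M, TangentSpace I x} {x : M}
    (hY : MDiffAt (T% Y) x) (v w : TangentSpace I x) :
    inner ℝ (leviCivitaFun Y x v) w = 1 / 2 * koszul Y (extend E v) (extend E w) x := by
  have := two_mul_inner_leviCivitaFun hY (mdifferentiableAt_extend I E v)
    (mdifferentiableAt_extend I E w)
  simp only [extend_apply_self] at this
  linarith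

variable (I M) in
/-- The Levi-Civita connection of the Riemannian metric on `M`. In Mathlib's argument order,
`leviCivita I M Y x v` is `∇_v Y` at `x`. -/
def leviCivita : CovariantDerivative I E (fun x : M => TangentSpace I x) where
  toFun := leviCivitaFun
  isCovariantDerivativeOnUniv :=
    { add := by
        intro Y Y' x hY hY' _
        ext v
        refine ext_inner_right ℝ fun w => ?_
        have hs : MDiffAt (T% (Y + Y')) x := mdifferentiableAt_add_section hY hY'
        rw [add_apply, inner_add_left, inner_leviCivitaFun hs,
          inner_leviCivitaFun hY, inner_leviCivitaFun hY',
          koszul_add hY hY' (mdifferentiableAt_extend I E v) (mdifferentiableAt_extend I E w)]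
        ring
      leibniz := by
        intro Y f x hY hf _
        ext v
        refine ext_inner_right ℝ fun w => ?_
        have hs : MDiffAt (T% (f • Y)) x := hf.smul_section hY
        rw [inner_leviCivitaFun hs, koszul_smul hf hY (mdifferentiableAt_extend I E v)
          (mdifferentiableAt_extend I E w)]
        simp only [add_apply, smul_apply,
          ContinuousLinearMap.smulRight_apply, inner_add_left, inner_smul_left,
          inner_leviCivitaFun hY, extend_apply_self]
        simp
        ring }

theorem two_mul_inner_leviCivita {Y V W : Π x : M, TangentSpace I x} {x : M}
    (hY : MDiffAt (T% Y) x) (hV : MDiffAt (T% V) x) (hW : MDiffAt (T% W) x) :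
    2 * inner ℝ (leviCivita I M Y x (V x)) (W x) = koszul Y V W x :=
  two_mul_inner_leviCivitaFun hY hV hW

/-- The Levi-Civita connection is torsion-free. -/
theorem torsion_leviCivita : (leviCivita I M).torsion = 0 := by
  rw [CovariantDerivative.torsion_eq_zero_iff]
  intro V Y x hV hY
  refine ext_inner_right ℝ fun w => ?_
  have hw := mdifferentiableAt_extend I E w
  have h1 := two_mul_inner_leviCivita hY hV hw
  have h2 := two_mul_inner_leviCivita hV hY hw
  simp only [extend_apply_self] at h1 h2
  rw [inner_sub_left]
  have e1 := mlieBracket_swap_apply (I := I) (V := V) (W := Y) (x := x)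
  simp only [koszul, e1, inner_neg_left, extend_apply_self] at h1 h2
  have e2 : (fun y : M => inner ℝ (V y) (Y y)) = fun y : M => inner ℝ (Y y) (V y) :=
    funext fun y => real_inner_comm _ _
  rw [e1, inner_neg_left]
  rw [e2] at h1
  linarith

/-- The Levi-Civita connection is compatible with the metric. -/
theorem isMetricCompatible_leviCivita :
    CovariantDerivative.IsMetricCompatible (V := fun x : M => TangentSpace I x)
      (leviCivita I M) := by
  rw [CovariantDerivative.isMetricCompatible_iff]
  intro x V Y Z hV hY hZ
  have h1 := two_mul_inner_leviCivita hY hV hZ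
  have h2 := two_mul_inner_leviCivita hZ hV hY
  have e1 : (fun y : M => inner ℝ (Z y) (Y y)) = fun y : M => inner ℝ (Y y) (Z y) :=
    funext fun y => real_inner_comm _ _
  have e2 := mlieBracket_swap_apply (I := I) (V := Z) (W := Y) (x := x)
  simp only [koszul, e1, e2, inner_neg_left] at h1 h2
  have e3 : inner ℝ (Y x) (leviCivita I M Z x (V x)) = inner ℝ (leviCivita I M Z x (V x)) (Y x) :=
    real_inner_comm _ _
  beta_reduce
  rw [e3]
  linarith

/-- The Riemann curvature `R(V, W)Z = ∇_V ∇_W Z - ∇_W ∇_V Z - ∇_{[V, W]} Z` at `x`. -/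
def curvature (V W Z : Π x : M, TangentSpace I x) (x : M) : TangentSpace I x :=
  leviCivita I M (fun y => leviCivita I M Z y (W y)) x (V x)
    - leviCivita I M (fun y => leviCivita I M Z y (V y)) x (W x)
    - leviCivita I M Z x (mlieBracket I V W x)

/-- The Ricci curvature `Ric(X_p)` in the direction of the smooth vector field `X`, i.e. the trace
of `v ↦ R(v, X)X` on `T_p M`. It is computed in an orthonormal basis of `T_p M`, each basis vector
being extended to a vector field that is smooth near `p`. -/
def ricci (X : Π x : M, TangentSpace I x) (p : M) : ℝ :=
  ∑ i, inner ℝ (curvature (extend E (stdOrthonormalBasis ℝ (TangentSpace I p) i)) X X p)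
    (stdOrthonormalBasis ℝ (TangentSpace I p) i)

/-- `X` is a geodesic vector field: a smooth unit vector field with `∇_X X = 0`. -/
structure IsGeodesicField (X : Π x : M, TangentSpace I x) : Prop where
  smooth : ContMDiff I I.tangent ∞ (fun x => (⟨x, X x⟩ : TangentBundle I M))
  norm_eq_one : ∀ x, ‖X x‖ = 1
  geodesic : ∀ x, leviCivita I M X x (X x) = 0

theorem IsGeodesicField.inner_leviCivita_eq_zero {X : Π x : M, TangentSpace I x}
    (hX : IsGeodesicField X) (p : M) (v : TangentSpace I p) :
    inner ℝ (X p) (leviCivita I M X p v) = 0 := by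
  have hd : MDiffAt (T% X) p := (hX.smooth p).mdifferentiableAt (by simp)
  have h := two_mul_inner_leviCivita hd (mdifferentiableAt_extend I E v) hd
  have hc : (fun x : M => inner ℝ (X x) (X x)) = fun _ => (1 : ℝ) := by
    funext x
    rw [real_inner_self_eq_norm_sq, hX.norm_eq_one x, one_pow]
  have h0 : d% (fun _ : M => (1 : ℝ)) p = 0 := mvfderiv_const 1
  rw [koszul, hc, h0, mlieBracket_self] at h
  simp only [extend_apply_self, zero_apply, Pi.zero_apply, inner_zero_left] at h
  have e : inner ℝ (X p) (leviCivita I M X p v) = inner ℝ (leviCivita I M X p v) (X p) :=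
    real_inner_comm _ _
  rw [e]
  linarith

/-- The endomorphism `β_p : X_p^⊥ → X_p^⊥`, `v ↦ ∇_v X`. -/
def beta {X : Π x : M, TangentSpace I x} (hX : IsGeodesicField X) (p : M) :
    (Submodule.span ℝ {X p})ᗮ →ₗ[ℝ] (Submodule.span ℝ {X p})ᗮ :=
  ((leviCivita I M X p).toLinearMap.comp (Submodule.subtype _)).codRestrict _ fun v =>
    Submodule.mem_orthogonal_singleton_iff_inner_right.2 (hX.inner_leviCivita_eq_zero p v)

/-- `l` and `m` are the two complex eigenvalues of `β_p`, counted with multiplicity. -/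
def IsEigenvaluePair {X : Π x : M, TangentSpace I x} (hX : IsGeodesicField X) (p : M)
    (l m : ℂ) : Prop :=
  (beta hX p).charpoly.aroots ℂ = {l, m}

/-- The 1-form `α = i_X g`, i.e. `α(v) = ⟨X, v⟩`. -/
def dualForm (X : Π x : M, TangentSpace I x) (x : M) : TangentSpace I x →L[ℝ] ℝ :=
  innerSL ℝ (X x)

/-- The exterior derivative of a 1-form,
`dα(v, w) = V(α(W)) - W(α(V)) - α([V, W])`, where `V`, `W` are vector fields that extend `v`, `w`
and are smooth near `x`. -/
def exteriorDeriv (α : Π x : M, TangentSpace I x →L[ℝ] ℝ) (x : M)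
    (v w : TangentSpace I x) : ℝ :=
  d% (fun y : M => α y (extend E w y)) x v - d% (fun y : M => α y (extend E v y)) x w
    - α x (mlieBracket I (extend E v) (extend E w) x)

/-- The 3-form `α ∧ dα`. -/
def wedgeExteriorDeriv (α : Π x : M, TangentSpace I x →L[ℝ] ℝ) (x : M)
    (u v w : TangentSpace I x) : ℝ :=
  α x u * exteriorDeriv α x v w + α x v * exteriorDeriv α x w u + α x w * exteriorDeriv α x u v

/-- The plane field `X^⊥ = ker α`, `α = i_X g`, on a 3-manifold is contact at `p`:
`α ∧ dα ≠ 0` at `p`. -/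
def IsContactAt (X : Π x : M, TangentSpace I x) (p : M) : Prop :=
  ∃ u v w : TangentSpace I p, wedgeExteriorDeriv (dualForm X) p u v w ≠ 0

/-- `X` induces a contact structure: `X^⊥` is contact at every point. -/
def InducesContactStructure (X : Π x : M, TangentSpace I x) : Prop :=
  ∀ p, IsContactAt X p


/-- `X` is complete: its integral curves exist for all time. -/
def IsCompleteField (X : Π x : M, TangentSpace I x) : Prop :=
  ∀ p, ∃ γ : ℝ → M, γ 0 = p ∧ IsMIntegralCurve γ X

end GeodesicField

end

/-! Let α = ⟨X, ·⟩. Torsion-freeness and metric compatibility identify dα with twice the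
antisymmetric part of ∇X (`curlForm`). Since X is a unit geodesic field, i_X dα = 0. Two things
follow. Evaluating α ∧ dα on (X, v, w) gives dα(v, w), so failure of contact at p forces dα = 0 at
p, i.e. β_p is symmetric. And L_X dα = 0, so in a local frame dα solves a linear ODE along integral
curves; if it vanishes at p, it vanishes along the whole curve through p
(`curlForm_eq_zero_of_integralCurve`).

Along that curve put h = tr ∇X = tr β. Tracing the curvature gives the Riccati equation h' = -Ric(X)
- tr β² (`trace_riccati`). Symmetry of β makes λ, μ real, so tr β² = |λ - μ|²/2 + h²/2, and the
curvature hypothesis becomes h' ≤ -h²/2. By completeness this holds for all time, and a nonzero h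
would blow up in finite time, forwards or backwards (`eq_zero_of_deriv_le_neg_sq`). Hence h = 0 and
h' = 0, so Ric(X) = -tr β² = -‖β‖², with the Hilbert-Schmidt norm. This is negative unless β = 0,
which is (a). Part (b) follows because Ric(X) ≥ 0 implies the hypothesis of (a). -/

noncomputable section

namespace GeodesicField

/-! ### Lie brackets as commutators of derivations. -/

section LieDerivative

variable {E : Type*} [NormedAddCommGroup E] [NormedSpace ℝ E]
  {H : Type*} [TopologicalSpace H] {I : ModelWithCorners ℝ E H}
  {M : Type*} [TopologicalSpace M] [ChartedSpace H M] [IsManifold I ∞ M]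

theorem eventually_mdifferentiableAt_section {V : Π x : M, TangentSpace I x} {x : M}
    (hV : CMDiffAt ∞ (T% V) x) : ∀ᶠ y in nhds x, MDiffAt (T% V) y := by
  have h1 : CMDiffAt 1 (T% V) x := hV.of_le (by simp)
  filter_upwards [(contMDiffAt_iff_contMDiffAt_nhds (by simp)).1 h1] with y hy
  exact hy.mdifferentiableAt (by simp)

theorem eventually_mdifferentiableAt {f : M → ℝ} {x : M}
    (hf : CMDiffAt ∞ f x) : ∀ᶠ y in nhds x, MDiffAt f y := by
  have h1 : CMDiffAt 1 f x := hf.of_le (by simp)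
  filter_upwards [(contMDiffAt_iff_contMDiffAt_nhds (by simp)).1 h1] with y hy
  exact hy.mdifferentiableAt (by simp)

variable [CompleteSpace E]

theorem contMDiffAt_mlieBracket {V W : Π x : M, TangentSpace I x} {x : M}
    (hV : CMDiffAt ∞ (T% V) x) (hW : CMDiffAt ∞ (T% W) x) :
    CMDiffAt ∞ (T% (mlieBracket I V W)) x := by
  have : IsManifold I (((⊤ : ℕ∞) : ℕ∞ω) + 1) M := inferInstanceAs (IsManifold I ∞ M)
  have : IsManifold I (minSmoothness ℝ 2) M := by
    rw [minSmoothness_of_isRCLikeNormedField]; infer_instance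
  exact ContMDiffAt.mlieBracket_vectorField (m := ⊤) (n := ⊤) hV hW (by simp)

theorem mlieBracket_fun_smul {f : M → ℝ} {V W : Π x : M, TangentSpace I x} {y : M}
    (hf : MDiffAt f y) (hW : MDiffAt (T% W) y) :
    mlieBracket I V (fun z => f z • W z) y =
      d% f y (V y) • W y + f y • mlieBracket I V W y :=
  mlieBracket_smul_right hf hW

variable [FiniteDimensional ℝ E]

/-- The Leibniz rule gives [V, f W] - f [V, W] = (V f) W. Taking W from a local frame, V f is a
frame coefficient of a field built from smooth brackets. -/
theorem contMDiffAt_mvfderiv_apply [Nontrivial E] {f : M → ℝ} {V : Π x : M, TangentSpace I x}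
    {x : M} (hf : CMDiffAt ∞ f x) (hV : CMDiffAt ∞ (T% V) x) :
    CMDiffAt ∞ (fun y => d% f y (V y)) x := by
  let b := Module.finBasis ℝ E
  obtain ⟨i⟩ : Nonempty (Fin (Module.finrank ℝ E)) := b.index_nonempty
  let t := trivializationAt E (TangentSpace I) x
  have hx : x ∈ t.baseSet := FiberBundle.mem_baseSet_trivializationAt' x
  let W := t.localFrame b i
  have hW : CMDiffAt ∞ (T% W) x := contMDiffAt_localFrame_of_mem ∞ t b i hx
  have hfW : CMDiffAt ∞ (T% (fun y => f y • W y)) x := hf.smul_section hW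
  have key : CMDiffAt ∞
      (T% (fun y => mlieBracket I V (fun y => f y • W y) y - f y • mlieBracket I V W y)) x :=
    (contMDiffAt_mlieBracket hV hfW).sub_section (hf.smul_section (contMDiffAt_mlieBracket hV hW))
  have h2 := contMDiffAt_localFrameCoeff (e := t) b hx key i
  refine h2.congr_of_eventuallyEq ?_
  filter_upwards [eventually_mdifferentiableAt hf, eventually_mdifferentiableAt_section hW,
    t.open_baseSet.mem_nhds hx] with y hfy hWy hy
  have : (W y) = t.basisAt b hy i := t.localFrame_apply_of_mem_baseSet b hy
  have e := t.localFrameCoeff_apply_of_mem_baseSet (I := I) b hy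
    (fun y => mlieBracket I V (fun y => f y • W y) y - f y • mlieBracket I V W y) i
  rw [LinearMap.piApply_apply_apply]
  refine Eq.trans ?_ e.symm
  rw [mlieBracket_fun_smul hfy hWy, this]
  simp

/-- The Lie bracket acts on functions as the commutator of derivations. -/
theorem mvfderiv_mlieBracket [Nontrivial E] {f : M → ℝ} {U V : Π x : M, TangentSpace I x} {x : M}
    (hf : CMDiffAt ∞ f x) (hU : CMDiffAt ∞ (T% U) x) (hV : CMDiffAt ∞ (T% V) x) :
    d% f x (mlieBracket I U V x) =
      d% (fun y => d% f y (V y)) x (U x) - d% (fun y => d% f y (U y)) x (V x) := by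
  have : IsManifold I (minSmoothness ℝ 3) M := by
    rw [minSmoothness_of_isRCLikeNormedField]; infer_instance
  obtain ⟨w, hw⟩ := exists_ne (0 : E)
  let w' : TangentSpace I x := w
  let W : Π x : M, TangentSpace I x := extend E w'
  have hW : CMDiffAt ∞ (T% W) x := contMDiffAt_extend I E _
  have hWx : W x ≠ 0 := by rw [show W x = w' from extend_apply_self E w']; exact hw
  have of2 {Z : Π x : M, TangentSpace I x} (hZ : CMDiffAt ∞ (T% Z) x) :
      CMDiffAt (minSmoothness ℝ 2) (T% Z) x :=
    hZ.of_le (by rw [minSmoothness_of_isRCLikeNormedField]; exact ENat.LEInfty.out)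
  have md {Z : Π x : M, TangentSpace I x} (hZ : CMDiffAt ∞ (T% Z) x) : MDiffAt (T% Z) x :=
    hZ.mdifferentiableAt (by simp)
  have mf {g : M → ℝ} (hg : CMDiffAt ∞ g x) : MDiffAt g x := hg.mdifferentiableAt (by simp)
  have hfW : CMDiffAt ∞ (T% (fun y => f y • W y)) x := hf.smul_section hW
  have ev (Z : Π x : M, TangentSpace I x) :
      mlieBracket I Z (fun y => f y • W y) =ᶠ[nhds x]
        (fun y => d% f y (Z y) • W y) + fun y => f y • mlieBracket I Z W y := by
    filter_upwards [eventually_mdifferentiableAt hf, eventually_mdifferentiableAt_section hW]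
      with y hfy hWy
    exact mlieBracket_fun_smul hfy hWy
  have exp {Z Z' : Π x : M, TangentSpace I x} (hZ : CMDiffAt ∞ (T% Z) x) :
      mlieBracket I Z' (mlieBracket I Z (fun y => f y • W y)) x =
        d% (fun y => d% f y (Z y)) x (Z' x) • W x + d% f x (Z x) • mlieBracket I Z' W x +
        (d% f x (Z' x) • mlieBracket I Z W x + f x • mlieBracket I Z' (mlieBracket I Z W) x) := by
    have hdf := contMDiffAt_mvfderiv_apply hf hZ
    have hZW := contMDiffAt_mlieBracket hZ hW
    rw [Filter.EventuallyEq.mlieBracket_vectorField_eq (Filter.EventuallyEq.refl _ Z') (ev Z),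
      mlieBracket_add_right (W := fun y => d% f y (Z y) • W y)
        (W₁ := fun y => f y • mlieBracket I Z W y) (md (hdf.smul_section hW))
        (md (hf.smul_section hZW)),
      mlieBracket_fun_smul (mf hdf) (md hW), mlieBracket_fun_smul (mf hf) (md hZW)]
  -- The Jacobi identity for U, V, f W minus f times the one for U, V, W leaves only the defect of
  -- the commutator formula, multiplied by W, which is nonzero at x.
  have jac := leibniz_identity_mlieBracket_apply (of2 hU) (of2 hV) (of2 hfW)
  have jac' := leibniz_identity_mlieBracket_apply (of2 hU) (of2 hV) (of2 hW)
  rw [exp hV, exp hU, mlieBracket_fun_smul (mf hf) (md hW), jac'] at jac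
  have : (d% (fun y => d% f y (V y)) x (U x) - d% (fun y => d% f y (U y)) x (V x)
      - d% f x (mlieBracket I U V x)) • W x = 0 := by
    rw [← sub_eq_zero] at jac
    rw [← jac]
    module
  rcases smul_eq_zero.1 this with h | h
  · linarith
  · exact absurd h hWx

end LieDerivative

/-! ### Smoothness of covariant derivatives. -/

section Smoothness

variable {E : Type*} [NormedAddCommGroup E] [NormedSpace ℝ E]
  {H : Type*} [TopologicalSpace H] {I : ModelWithCorners ℝ E H}
  {M : Type*} [TopologicalSpace M] [ChartedSpace H M]

theorem contMDiffAt_matrix_det {ι : Type*} [Fintype ι] [DecidableEq ι] {A : M → Matrix ι ι ℝ}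
    {x : M} (hA : ∀ i j, CMDiffAt ∞ (fun y => A y i j) x) :
    CMDiffAt ∞ (fun y => (A y).det) x := by
  simp only [Matrix.det_apply']
  refine contMDiffAt_finsetSum fun σ _ =>
    contMDiffAt_const.mul (contMDiffAt_finsetProd fun i _ => hA _ _)

theorem contMDiffAt_matrix_adjugate {ι : Type*} [Fintype ι] [DecidableEq ι]
    {A : M → Matrix ι ι ℝ} {x : M} (hA : ∀ i j, CMDiffAt ∞ (fun y => A y i j) x) (i j : ι) :
    CMDiffAt ∞ (fun y => (A y).adjugate i j) x := by
  simp only [Matrix.adjugate_apply]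
  refine contMDiffAt_matrix_det fun k l => ?_
  by_cases h : k = j
  · subst h; simpa using contMDiffAt_const
  · simpa [Matrix.updateRow_ne h] using hA k l

variable [RiemannianBundle (fun x : M => TangentSpace I x)] [IsManifold I ∞ M]
  [IsContMDiffRiemannianBundle I ∞ E (fun x : M => TangentSpace I x)]

theorem contMDiffAt_inner {V W : Π x : M, TangentSpace I x} {x : M}
    (hV : CMDiffAt ∞ (T% V) x) (hW : CMDiffAt ∞ (T% W) x) :
    CMDiffAt ∞ (fun y => inner ℝ (V y) (W y)) x :=
  ContMDiffAt.inner_bundle (E := fun x : M => TangentSpace I x) (b := fun x => x) hV hW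

variable [FiniteDimensional ℝ E]

/-- A vector field is smooth at `x` if its inner products with smooth fields are. -/
theorem contMDiffAt_of_inner {Z : Π x : M, TangentSpace I x} {x : M}
    (h : ∀ W : Π x : M, TangentSpace I x, CMDiffAt ∞ (T% W) x →
      CMDiffAt ∞ (fun y => inner ℝ (Z y) (W y)) x) :
    CMDiffAt ∞ (T% Z) x := by
  let b := Module.finBasis ℝ E
  let t := trivializationAt E (TangentSpace I) x
  have hx : x ∈ t.baseSet := FiberBundle.mem_baseSet_trivializationAt' x
  let s := t.localFrame b
  have hs i : CMDiffAt ∞ (T% (s i)) x := contMDiffAt_localFrame_of_mem ∞ t b i hx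
  let G : M → Matrix _ _ ℝ := fun y => Matrix.of fun i j => inner ℝ (s i y) (s j y)
  have hG i j : CMDiffAt ∞ (fun y => G y i j) x := contMDiffAt_inner (hs i) (hs j)
  have hs' {y : M} (hy : y ∈ t.baseSet) i : s i y = t.basisAt b hy i :=
    t.localFrame_apply_of_mem_baseSet b hy
  have hdet {y : M} (hy : y ∈ t.baseSet) : (G y).det ≠ 0 := by
    have : G y = Matrix.gram ℝ (t.basisAt b hy) := by
      ext i j
      simp [G, Matrix.gram, hs' hy]
    rw [this]
    exact Matrix.det_gram_ne_zero_iff_linearIndependent.2 (t.basisAt b hy).linearIndependent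
  rw [contMDiffAt_iff_localFrameCoeff (e := t) b hx]
  intro i
  -- Cramer's rule: the frame coefficients of Z solve the linear system with Gram matrix G and
  -- right-hand side ⟨Z, s j⟩, and G is invertible where s is a frame.
  have key : CMDiffAt ∞
      (fun y => (∑ j, (G y).adjugate i j * inner ℝ (Z y) (s j y)) / (G y).det) x :=
    ContMDiffAt.div₀ (contMDiffAt_finsetSum fun j _ =>
      (contMDiffAt_matrix_adjugate hG i j).mul (h _ (hs j))) (contMDiffAt_matrix_det hG) (hdet hx)
  refine key.congr_of_eventuallyEq ?_
  filter_upwards [t.open_baseSet.mem_nhds hx] with y hy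
  have e := t.localFrameCoeff_apply_of_mem_baseSet (I := I) b hy Z i
  rw [LinearMap.piApply_apply_apply]
  refine e.trans ?_
  let c := (t.basisAt b hy).repr (Z y)
  have h1 : (fun j => inner ℝ (Z y) (s j y)) = (G y).mulVec c := by
    ext j
    have : Z y = ∑ k, c k • s k y := by
      simp only [hs' hy]
      exact ((t.basisAt b hy).sum_repr (Z y)).symm
    rw [this, sum_inner]
    simp only [Matrix.mulVec, dotProduct, G, Matrix.of_apply, inner_smul_left]
    refine Finset.sum_congr rfl fun k _ => ?_
    rw [real_inner_comm (s k y) (s j y)]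
    simp [mul_comm]
  have h2 := congrFun (congrArg (fun v => (G y).adjugate.mulVec v) h1) i
  simp only [Matrix.mulVec_mulVec, Matrix.adjugate_mul, Matrix.smul_mulVec, Matrix.one_mulVec] at h2
  rw [eq_div_iff (hdet hy)]
  simp only [Matrix.mulVec, dotProduct, Pi.smul_apply, smul_eq_mul] at h2
  rw [h2, mul_comm]

/-- By the Koszul formula, the inner product with a smooth field is a combination of derivatives and
brackets of smooth data. -/
theorem contMDiffAt_leviCivita [Nontrivial E] {Y V : Π x : M, TangentSpace I x} {x : M}
    (hY : CMDiffAt ∞ (T% Y) x) (hV : CMDiffAt ∞ (T% V) x) :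
    CMDiffAt ∞ (T% (fun y => leviCivita I M Y y (V y))) x := by
  refine contMDiffAt_of_inner fun W hW => ?_
  have key : CMDiffAt ∞ (fun y => 1 / 2 * koszul Y V W y) x := by
    refine contMDiffAt_const.mul ?_
    have h1 := contMDiffAt_mvfderiv_apply (contMDiffAt_inner hY hW) hV
    have h2 := contMDiffAt_mvfderiv_apply (contMDiffAt_inner hV hW) hY
    have h3 := contMDiffAt_mvfderiv_apply (contMDiffAt_inner hV hY) hW
    have h4 := contMDiffAt_inner (contMDiffAt_mlieBracket hV hY) hW
    have h5 := contMDiffAt_inner (contMDiffAt_mlieBracket hV hW) hY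
    have h6 := contMDiffAt_inner (contMDiffAt_mlieBracket hY hW) hV
    exact ((((h1.add h2).sub h3).add h4).sub h5).sub h6
  refine key.congr_of_eventuallyEq ?_
  filter_upwards [eventually_mdifferentiableAt_section hY, eventually_mdifferentiableAt_section hV,
    eventually_mdifferentiableAt_section hW] with y hYy hVy hWy
  rw [← two_mul_inner_leviCivita hYy hVy hWy]
  ring

end Smoothness

theorem mvfderiv_congr {E : Type*} [NormedAddCommGroup E] [NormedSpace ℝ E]
    {H : Type*} [TopologicalSpace H] {I : ModelWithCorners ℝ E H}
    {M : Type*} [TopologicalSpace M] [ChartedSpace H M] {f g : M → ℝ} {x : M}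
    (h : f =ᶠ[nhds x] g) : d% f x = d% g x := by
  simp only [mvfderiv, h.mfderiv_eq]
  rfl

/-! ### The exterior derivative of α and its invariance under X. -/

section Curl

variable {E : Type*} [NormedAddCommGroup E] [NormedSpace ℝ E]
  {H : Type*} [TopologicalSpace H] {I : ModelWithCorners ℝ E H}
  {M : Type*} [TopologicalSpace M] [ChartedSpace H M]
  [RiemannianBundle (fun x : M => TangentSpace I x)] [IsManifold I ∞ M]
  [IsContMDiffRiemannianBundle I ∞ E (fun x : M => TangentSpace I x)]
  [FiniteDimensional ℝ E]

/-- Twice the antisymmetric part of `∇X`, i.e. `(v, w) ↦ ⟨∇_v X, w⟩ - ⟨∇_w X, v⟩`. -/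
def curlForm (X : Π x : M, TangentSpace I x) (x : M) (v w : TangentSpace I x) : ℝ :=
  inner ℝ (leviCivita I M X x v) w - inner ℝ (leviCivita I M X x w) v

theorem curlForm_swap (X : Π x : M, TangentSpace I x) (x : M) (v w : TangentSpace I x) :
    curlForm X x v w = - curlForm X x w v := by
  simp [curlForm]

theorem curlForm_add_left (X : Π x : M, TangentSpace I x) (x : M) (v v' w : TangentSpace I x) :
    curlForm X x (v + v') w = curlForm X x v w + curlForm X x v' w := by
  simp only [curlForm, map_add, inner_add_left, inner_add_right]; ring

theorem curlForm_smul_left (X : Π x : M, TangentSpace I x) (x : M) (a : ℝ)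
    (v w : TangentSpace I x) : curlForm X x (a • v) w = a * curlForm X x v w := by
  simp only [curlForm, map_smul, inner_smul_left, inner_smul_right]; simp; ring

theorem curlForm_sum_left (X : Π x : M, TangentSpace I x) (x : M) {ι : Type*} (s : Finset ι)
    (a : ι → ℝ) (v : ι → TangentSpace I x) (w : TangentSpace I x) :
    curlForm X x (∑ i ∈ s, a i • v i) w = ∑ i ∈ s, a i * curlForm X x (v i) w := by
  classical
  induction s using Finset.induction_on with
  | empty => simp [curlForm]
  | insert i s hi h =>
    rw [Finset.sum_insert hi, Finset.sum_insert hi, curlForm_add_left, curlForm_smul_left, h]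

theorem curlForm_sum_right (X : Π x : M, TangentSpace I x) (x : M) {ι : Type*} (s : Finset ι)
    (a : ι → ℝ) (v : ι → TangentSpace I x) (w : TangentSpace I x) :
    curlForm X x w (∑ i ∈ s, a i • v i) = ∑ i ∈ s, a i * curlForm X x w (v i) := by
  rw [curlForm_swap, curlForm_sum_left, ← Finset.sum_neg_distrib]
  refine Finset.sum_congr rfl fun i _ => ?_
  rw [curlForm_swap X x w]; ring

theorem leviCivita_sub_eq_mlieBracket {V W : Π x : M, TangentSpace I x} {x : M}
    (hV : MDiffAt (T% V) x) (hW : MDiffAt (T% W) x) :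
    leviCivita I M W x (V x) - leviCivita I M V x (W x) = mlieBracket I V W x := by
  have ht := torsion_leviCivita (I := I) (M := M)
  rw [CovariantDerivative.torsion_eq_zero_iff] at ht
  exact ht hV hW

theorem mvfderiv_inner {V Y Z : Π x : M, TangentSpace I x} {x : M}
    (hV : MDiffAt (T% V) x) (hY : MDiffAt (T% Y) x) (hZ : MDiffAt (T% Z) x) :
    d% (fun y : M => inner ℝ (Y y) (Z y)) x (V x) =
      inner ℝ (leviCivita I M Y x (V x)) (Z x) + inner ℝ (Y x) (leviCivita I M Z x (V x)) := by
  have hm := isMetricCompatible_leviCivita (I := I) (M := M)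
  rw [CovariantDerivative.isMetricCompatible_iff] at hm
  exact hm hV hY hZ

/-- The antisymmetric part of `∇X` is the exterior derivative of `⟨X, ·⟩`. -/
theorem curlForm_eq {X V W : Π x : M, TangentSpace I x} {x : M} (hX : MDiffAt (T% X) x)
    (hV : MDiffAt (T% V) x) (hW : MDiffAt (T% W) x) :
    curlForm X x (V x) (W x) =
      d% (fun y : M => inner ℝ (X y) (W y)) x (V x) - d% (fun y : M => inner ℝ (X y) (V y)) x (W x)
        - inner ℝ (X x) (mlieBracket I V W x) := by
  have ht := leviCivita_sub_eq_mlieBracket hV hW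
  rw [mvfderiv_inner hV hX hW, mvfderiv_inner hW hX hV, ← ht, inner_sub_right, curlForm]
  ring

theorem exteriorDeriv_dualForm {X : Π x : M, TangentSpace I x} {x : M} (hX : MDiffAt (T% X) x)
    (v w : TangentSpace I x) : exteriorDeriv (dualForm X) x v w = curlForm X x v w := by
  have := curlForm_eq hX (mdifferentiableAt_extend I E v) (mdifferentiableAt_extend I E w)
  simp only [extend_apply_self] at this
  rw [this]
  rfl

variable {X : Π x : M, TangentSpace I x}

/-- This is i_X dα = 0: one term vanishes because ∇_X X = 0, the other because X has constant
length. -/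
theorem IsGeodesicField.curlForm_self_left (hX : IsGeodesicField X) (x : M)
    (w : TangentSpace I x) : curlForm X x (X x) w = 0 := by
  rw [curlForm, hX.geodesic, inner_zero_left, real_inner_comm, hX.inner_leviCivita_eq_zero,
    sub_zero]

theorem IsGeodesicField.curlForm_self_right (hX : IsGeodesicField X) (x : M)
    (w : TangentSpace I x) : curlForm X x w (X x) = 0 := by
  rw [curlForm_swap, hX.curlForm_self_left, neg_zero]

theorem IsGeodesicField.mdifferentiableAt (hX : IsGeodesicField X) (x : M) :
    MDiffAt (T% X) x :=
  (hX.smooth x).mdifferentiableAt (by simp)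

/-- This is L_X α = 0, obtained from i_X dα = 0 and α(X) = 1. -/
theorem IsGeodesicField.inner_mlieBracket (hX : IsGeodesicField X)
    {W : Π x : M, TangentSpace I x} {x : M} (hW : MDiffAt (T% W) x) :
    inner ℝ (X x) (mlieBracket I X W x) = d% (fun y : M => inner ℝ (X y) (W y)) x (X x) := by
  have h := curlForm_eq (hX.mdifferentiableAt x) (hX.mdifferentiableAt x) hW
  have hc : (fun x : M => inner ℝ (X x) (X x)) = fun _ => (1 : ℝ) := by
    funext x
    rw [real_inner_self_eq_norm_sq, hX.norm_eq_one x, one_pow]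
  have h0 : d% (fun _ : M => (1 : ℝ)) x = 0 := mvfderiv_const 1
  rw [hX.curlForm_self_left, hc, h0] at h
  simp only [zero_apply] at h
  linarith

/-- The exterior derivative of `⟨X, ·⟩` is invariant under the flow of `X`. -/
theorem IsGeodesicField.mvfderiv_curlForm [Nontrivial E] (hX : IsGeodesicField X)
    {V W : Π x : M, TangentSpace I x} {x : M} (hV : CMDiffAt ∞ (T% V) x)
    (hW : CMDiffAt ∞ (T% W) x) :
    d% (fun y : M => curlForm X y (V y) (W y)) x (X x) =
      curlForm X x (mlieBracket I X V x) (W x) + curlForm X x (V x) (mlieBracket I X W x) := by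
  have hXs := hX.smooth x
  have md {Z : Π x : M, TangentSpace I x} (hZ : CMDiffAt ∞ (T% Z) x) : MDiffAt (T% Z) x :=
    hZ.mdifferentiableAt (by simp)
  have mf {g : M → ℝ} (hg : CMDiffAt ∞ g x) : MDiffAt g x := hg.mdifferentiableAt (by simp)
  have hXV := contMDiffAt_mlieBracket hXs hV
  have hXW := contMDiffAt_mlieBracket hXs hW
  have hVW := contMDiffAt_mlieBracket hV hW
  have aV := contMDiffAt_inner hXs hV
  have aW := contMDiffAt_inner hXs hW
  have aVW := contMDiffAt_inner hXs hVW
  have e : (fun y : M => curlForm X y (V y) (W y)) =ᶠ[nhds x] fun y =>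
      d% (fun y : M => inner ℝ (X y) (W y)) y (V y) - d% (fun y : M => inner ℝ (X y) (V y)) y (W y)
        - inner ℝ (X y) (mlieBracket I V W y) := by
    filter_upwards [eventually_mdifferentiableAt_section hV,
      eventually_mdifferentiableAt_section hW] with y hVy hWy
    exact curlForm_eq (hX.mdifferentiableAt y) hVy hWy
  have inv {Z : Π x : M, TangentSpace I x} (hZ : CMDiffAt ∞ (T% Z) x) :
      (fun y : M => inner ℝ (X y) (mlieBracket I X Z y)) =ᶠ[nhds x]
        fun y => d% (fun y : M => inner ℝ (X y) (Z y)) y (X y) := by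
    filter_upwards [eventually_mdifferentiableAt_section hZ] with y hZy
    exact hX.inner_mlieBracket hZy
  have of2 {Z : Π x : M, TangentSpace I x} (hZ : CMDiffAt ∞ (T% Z) x) :
      CMDiffAt (minSmoothness ℝ 2) (T% Z) x :=
    hZ.of_le (by rw [minSmoothness_of_isRCLikeNormedField]; exact ENat.LEInfty.out)
  have : IsManifold I (minSmoothness ℝ 3) M := by
    rw [minSmoothness_of_isRCLikeNormedField]; infer_instance
  -- After expanding dα on both sides, second derivatives are matched by the commutator formula and
  -- L_X α = 0; the nested brackets are matched by the Jacobi identity.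
  have jac := leibniz_identity_mlieBracket_apply (of2 hXs) (of2 hV) (of2 hW)
  have d1 := contMDiffAt_mvfderiv_apply aW hV
  have d2 := contMDiffAt_mvfderiv_apply aV hW
  rw [mvfderiv_congr e, mvfderiv_fun_sub (mf (d1.sub d2)) (mf aVW), mvfderiv_fun_sub (mf d1) (mf d2),
    curlForm_eq (md hXs) (md hXV) (md hW), curlForm_eq (md hXs) (md hV) (md hXW),
    mvfderiv_congr (inv hV),
    mvfderiv_congr (inv hW), mvfderiv_mlieBracket aW hXs hV, mvfderiv_mlieBracket aV hXs hW]
  have j := congrArg (inner ℝ (X x)) jac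
  rw [hX.inner_mlieBracket (md hVW), inner_add_right] at j
  simp only [sub_apply]
  rw [j]
  ring

end Curl

/-- A solution of a linear differential inequality `‖u'‖ ≤ K ‖u‖` near `t₀` that vanishes at `t₀`
vanishes near `t₀`. -/
theorem eventually_eq_zero_of_norm_deriv_le {F : Type*} [NormedAddCommGroup F] [NormedSpace ℝ F]
    {u u' : ℝ → F} {t₀ K : ℝ} (hu : ∀ᶠ t in nhds t₀, HasDerivAt u (u' t) t)
    (hb : ∀ᶠ t in nhds t₀, ‖u' t‖ ≤ K * ‖u t‖) (h0 : u t₀ = 0) :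
    ∀ᶠ t in nhds t₀, u t = 0 := by
  obtain ⟨ε, hε, h⟩ := Metric.eventually_nhds_iff_ball.1 (hu.and hb)
  refine Metric.eventually_nhds_iff_ball.2 ⟨ε, hε, fun t ht => ?_⟩
  simp only [Metric.mem_ball, Real.dist_eq, abs_lt] at h ht
  rcases le_total t₀ t with hle | hle
  · refine eq_zero_of_abs_deriv_le_mul_abs_self_of_eq_zero_right (f := u) (f' := u') (K := K)
      (a := t₀) (b := t) ?_ ?_ h0 ?_ t ⟨hle, le_rfl⟩
    · intro s hs
      exact (h s ⟨by linarith [hs.1], by linarith [hs.2]⟩).1.continuousAt.continuousWithinAt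
    · intro s hs
      exact (h s ⟨by linarith [hs.1], by linarith [hs.2]⟩).1.hasDerivWithinAt
    · intro s hs
      exact (h s ⟨by linarith [hs.1], by linarith [hs.2]⟩).2
  -- The Grönwall argument runs forwards only; earlier times are reached by the reflection s ↦ 2 t₀
  -- - s.
  · have hd : ∀ s ∈ Set.Icc t₀ (2 * t₀ - t),
        HasDerivAt (fun s => u (2 * t₀ - s)) (-u' (2 * t₀ - s)) s := by
      intro s hs
      have h1 := (h (2 * t₀ - s) ⟨by linarith [hs.2], by linarith [hs.1]⟩).1
      have h2 : HasDerivAt (fun s : ℝ => 2 * t₀ - s) (-1) s := by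
        simpa using (hasDerivAt_id s).const_sub (2 * t₀)
      simpa [Function.comp_def] using h1.scomp s h2
    have := eq_zero_of_abs_deriv_le_mul_abs_self_of_eq_zero_right (f := fun s => u (2 * t₀ - s))
      (f' := fun s => -u' (2 * t₀ - s)) (K := K) (a := t₀) (b := 2 * t₀ - t)
      (fun s hs => (hd s hs).continuousAt.continuousWithinAt)
      (fun s hs => (hd s ⟨hs.1, hs.2.le⟩).hasDerivWithinAt)
      (by rw [show 2 * t₀ - t₀ = t₀ by ring]; exact h0)
      (fun s hs => by
        rw [norm_neg]
        exact (h (2 * t₀ - s) ⟨by linarith [hs.2], by linarith [hs.1]⟩).2)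
      (2 * t₀ - t) ⟨by linarith, le_rfl⟩
    simpa using this

theorem hasDerivAt_comp_integralCurve {E : Type*} [NormedAddCommGroup E] [NormedSpace ℝ E]
    {H : Type*} [TopologicalSpace H] {I : ModelWithCorners ℝ E H}
    {M : Type*} [TopologicalSpace M] [ChartedSpace H M] {X : Π x : M, TangentSpace I x}
    {γ : ℝ → M} (hγ : IsMIntegralCurve γ X) {f : M → ℝ} {t : ℝ} (hf : MDiffAt f (γ t)) :
    HasDerivAt (fun t => f (γ t)) (d% f (γ t) (X (γ t))) t := by
  have h := hf.hasMFDerivAt.comp t (hγ t)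
  have e : (mfderiv% f (γ t)).comp ((1 : ℝ →L[ℝ] ℝ).smulRight (X (γ t))) =
      (1 : ℝ →L[ℝ] ℝ).smulRight (d% f (γ t) (X (γ t))) := by
    ext
    change mfderiv% f (γ t) ((1 : ℝ) • X (γ t)) = (1 : ℝ) • d% f (γ t) (X (γ t))
    rw [one_smul, one_smul]
    rfl
  have h' : HasFDerivAt (fun t => f (γ t))
      ((1 : ℝ →L[ℝ] ℝ).smulRight (d% f (γ t) (X (γ t)))) t :=
    hasMFDerivAt_iff_hasFDerivAt.1 (e ▸ h)
  simpa using h'.hasDerivAt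

/-! ### Propagation of symmetry along integral curves. -/

section Propagation

variable {E : Type*} [NormedAddCommGroup E] [NormedSpace ℝ E]
  {H : Type*} [TopologicalSpace H] {I : ModelWithCorners ℝ E H}
  {M : Type*} [TopologicalSpace M] [ChartedSpace H M]
  [RiemannianBundle (fun x : M => TangentSpace I x)] [IsManifold I ∞ M]
  [IsContMDiffRiemannianBundle I ∞ E (fun x : M => TangentSpace I x)]
  [FiniteDimensional ℝ E] {X : Π x : M, TangentSpace I x}

theorem contMDiffAt_curlForm [Nontrivial E] {V W : Π x : M, TangentSpace I x} {x : M}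
    (hX : CMDiffAt ∞ (T% X) x) (hV : CMDiffAt ∞ (T% V) x) (hW : CMDiffAt ∞ (T% W) x) :
    CMDiffAt ∞ (fun y => curlForm X y (V y) (W y)) x :=
  (contMDiffAt_inner (contMDiffAt_leviCivita hX hV) hW).sub
    (contMDiffAt_inner (contMDiffAt_leviCivita hX hW) hV)

/-- If `∇X` is symmetric at one point of an integral curve of `X`, it is symmetric along the whole
curve. -/
theorem IsGeodesicField.curlForm_eq_zero_of_integralCurve [Nontrivial E] (hX : IsGeodesicField X)
    {γ : ℝ → M} (hγ : IsMIntegralCurve γ X) {t₀ : ℝ}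
    (h0 : ∀ v w, curlForm X (γ t₀) v w = 0) (t : ℝ) (v w : TangentSpace I (γ t)) :
    curlForm X (γ t) v w = 0 := by
  -- S is shown to be clopen in the connected line ℝ, working in a local frame near each time.
  let S : Set ℝ := {t | ∀ v w, curlForm X (γ t) v w = 0}
  have hlocal : ∀ t₁ : ℝ, (t₁ ∈ S → S ∈ nhds t₁) ∧ (t₁ ∉ S → Sᶜ ∈ nhds t₁) := by
    intro t₁
    let b := Module.finBasis ℝ E
    let e := trivializationAt E (TangentSpace I) (γ t₁)
    have hx : γ t₁ ∈ e.baseSet := FiberBundle.mem_baseSet_trivializationAt' (γ t₁)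
    let s := e.localFrame b
    have hs i {y : M} (hy : y ∈ e.baseSet) : CMDiffAt ∞ (T% (s i)) y :=
      contMDiffAt_localFrame_of_mem ∞ e b i hy
    let c := fun y i k => e.localFrameCoeff I b k y (mlieBracket I X (s i) y)
    have hexp {y : M} (hy : y ∈ e.baseSet) (Z : Π x : M, TangentSpace I x) :
        Z y = ∑ k, e.localFrameCoeff I b k y (Z y) • s k y :=
      e.eq_sum_localFrameCoeff_smul hy
    let u : ℝ → Fin (Module.finrank ℝ E) → Fin (Module.finrank ℝ E) → ℝ :=
      fun t i j => curlForm X (γ t) (s i (γ t)) (s j (γ t))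
    -- Expanding [X, s i] in the frame turns L_X dα = 0 into a linear ODE for the components u of
    -- dα.
    let u' : ℝ → Fin (Module.finrank ℝ E) → Fin (Module.finrank ℝ E) → ℝ := fun t i j =>
      ∑ k, c (γ t) i k * u t k j + ∑ k, c (γ t) j k * u t i k
    have hev : ∀ᶠ t in nhds t₁, γ t ∈ e.baseSet :=
      hγ.continuous.continuousAt.eventually (e.open_baseSet.mem_nhds hx)
    have hu : ∀ᶠ t in nhds t₁, HasDerivAt u (u' t) t := by
      filter_upwards [hev] with t ht
      refine hasDerivAt_pi.2 fun i => hasDerivAt_pi.2 fun j => ?_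
      have h1 := hasDerivAt_comp_integralCurve hγ (t := t)
        ((contMDiffAt_curlForm (hX.smooth _) (hs i ht) (hs j ht)).mdifferentiableAt (by simp))
      rw [hX.mvfderiv_curlForm (hs i ht) (hs j ht), hexp ht (mlieBracket I X (s i)),
        hexp ht (mlieBracket I X (s j)), curlForm_sum_left, curlForm_sum_right] at h1
      exact h1
    have hS : ∀ᶠ t in nhds t₁, (t ∈ S ↔ u t = 0) := by
      filter_upwards [hev] with t ht
      refine ⟨fun h => funext fun i => funext fun j => h _ _, fun h v w => ?_⟩
      have hv (v : TangentSpace I (γ t)) :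
          v = ∑ k, e.localFrameCoeff I b k (γ t) v • s k (γ t) := by
        have := hexp ht (extend E v)
        rwa [extend_apply_self] at this
      rw [hv v, hv w, curlForm_sum_left]
      refine Finset.sum_eq_zero fun i _ => ?_
      rw [curlForm_sum_right, Finset.sum_eq_zero, mul_zero]
      intro j _
      rw [show curlForm X (γ t) (s i (γ t)) (s j (γ t)) = 0 from congrFun (congrFun h i) j,
        mul_zero]
    refine ⟨fun h1 => ?_, fun h1 => ?_⟩
    · have hc i k : ContinuousAt (fun t => c (γ t) i k) t₁ := by
        have := contMDiffAt_localFrameCoeff (e := e) b hx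
          (contMDiffAt_mlieBracket (hX.smooth (γ t₁)) (hs i hx)) k
        exact ContinuousAt.comp (f := γ) (x := t₁) (g := fun y => c y i k) this.continuousAt
          hγ.continuous.continuousAt
      -- The extra 1 makes the bound strict at t₁, so by continuity it persists nearby.
      let C := ∑ i, ∑ k, |c (γ t₁) i k| + 1
      have hC : ∀ᶠ t in nhds t₁, ∀ i k, |c (γ t) i k| ≤ C := by
        have hsum : ContinuousAt (fun t => ∑ i, ∑ k, |c (γ t) i k|) t₁ :=
          tendsto_finsetSum _ fun i _ => tendsto_finsetSum _ fun k _ => (hc i k).abs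
        have hlt : ∀ᶠ t in nhds t₁, ∑ i, ∑ k, |c (γ t) i k| < C :=
          hsum.eventually_lt continuousAt_const (by simp [C])
        filter_upwards [hlt] with t ht i k
        refine le_trans ?_ ht.le
        refine (Finset.single_le_sum (f := fun k => |c (γ t) i k|) (fun _ _ => abs_nonneg _)
          (Finset.mem_univ k)).trans ?_
        exact Finset.single_le_sum (f := fun i => ∑ k, |c (γ t) i k|)
          (fun _ _ => Finset.sum_nonneg fun _ _ => abs_nonneg _) (Finset.mem_univ i)
      have hb : ∀ᶠ t in nhds t₁, ‖u' t‖ ≤ (2 * Module.finrank ℝ E * C) * ‖u t‖ := by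
        filter_upwards [hC] with t ht
        have hC0 : 0 ≤ C := by positivity
        have hterm i k l m : |c (γ t) i k * u t l m| ≤ C * ‖u t‖ := by
          rw [abs_mul]
          refine mul_le_mul (ht i k) ?_ (abs_nonneg _) hC0
          exact (norm_le_pi_norm (u t l) m).trans (norm_le_pi_norm (u t) l)
        have hnn : 0 ≤ (2 * Module.finrank ℝ E * C) * ‖u t‖ := by positivity
        refine (pi_norm_le_iff_of_nonneg hnn).2 fun i => (pi_norm_le_iff_of_nonneg hnn).2
          fun j => ?_
        refine (abs_add_le _ _).trans ?_
        have h1 : |∑ k, c (γ t) i k * u t k j| ≤ Module.finrank ℝ E * (C * ‖u t‖) := by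
          refine (Finset.abs_sum_le_sum_abs _ _).trans
            ((Finset.sum_le_sum fun k _ => hterm i k k j).trans ?_)
          simp
        have h2 : |∑ k, c (γ t) j k * u t i k| ≤ Module.finrank ℝ E * (C * ‖u t‖) := by
          refine (Finset.abs_sum_le_sum_abs _ _).trans
            ((Finset.sum_le_sum fun k _ => hterm j k i k).trans ?_)
          simp
        linarith
      filter_upwards [eventually_eq_zero_of_norm_deriv_le hu hb (hS.self_of_nhds.1 h1), hS]
        with t ht hSt
      exact hSt.2 ht
    -- The complement of S is open because u is continuous.
    · have hne : u t₁ ≠ 0 := fun h => h1 (hS.self_of_nhds.2 h)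
      filter_upwards [hu.self_of_nhds.continuousAt.eventually_ne hne, hS] with t ht hSt h
      exact ht (hSt.1 h)
  have hclopen : IsClopen S := by
    refine ⟨⟨isOpen_iff_mem_nhds.2 fun t₁ ht₁ => (hlocal t₁).2 ht₁⟩,
      isOpen_iff_mem_nhds.2 fun t₁ ht₁ => (hlocal t₁).1 ht₁⟩
  have huniv : S = Set.univ := hclopen.eq_univ ⟨t₀, h0⟩
  have : t ∈ S := huniv ▸ Set.mem_univ t
  exact this v w

end Propagation

/-! ### The Riccati equation for the trace of ∇X. -/

section Riccati

variable {E : Type*} [NormedAddCommGroup E] [NormedSpace ℝ E]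
  {H : Type*} [TopologicalSpace H] {I : ModelWithCorners ℝ E H}
  {M : Type*} [TopologicalSpace M] [ChartedSpace H M]

theorem mvfderiv_sum {ι : Type*} (s : Finset ι) {f : ι → M → ℝ} {p : M}
    (hf : ∀ i, MDiffAt (f i) p) :
    MDiffAt (fun y => ∑ i ∈ s, f i y) p ∧
      d% (fun y => ∑ i ∈ s, f i y) p = ∑ i ∈ s, d% (f i) p := by
  classical
  induction s using Finset.induction_on with
  | empty => simpa using ⟨mdifferentiableAt_const, mvfderiv_const 0⟩
  | insert i s hi h =>
    simp only [Finset.sum_insert hi]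
    exact ⟨(hf i).add h.1, by rw [mvfderiv_fun_add (hf i) h.1, h.2]⟩

/-- `extend` is constant in the trivialization at p, so the extensions of basis vectors used in
`ricci` form a local frame. -/
theorem extend_eq_localFrame [IsManifold I ∞ M] {ι : Type*} {p y : M}
    (hp : p ∈ (trivializationAt E (TangentSpace I) p).baseSet)
    (hy : y ∈ (trivializationAt E (TangentSpace I) p).baseSet)
    (o : Module.Basis ι ℝ (TangentSpace I p)) (k : ι) :
    extend E (o k) y = (trivializationAt E (TangentSpace I) p).localFrame
      (o.map ((trivializationAt E (TangentSpace I) p).linearEquivAt ℝ p hp)) k y := by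
  rw [Trivialization.localFrame_apply_of_mem_baseSet _ _ hy]
  simp [extend, Trivialization.basisAt]

variable [RiemannianBundle (fun x : M => TangentSpace I x)] [IsManifold I ∞ M]
  [IsContMDiffRiemannianBundle I ∞ E (fun x : M => TangentSpace I x)]
  [FiniteDimensional ℝ E] {X : Π x : M, TangentSpace I x}

theorem leviCivita_sum_smul {ι : Type*} (s : Finset ι) {a : ι → M → ℝ}
    {F : ι → Π x : M, TangentSpace I x} {p : M} (ha : ∀ i, MDiffAt (a i) p)
    (hF : ∀ i, MDiffAt (T% (F i)) p) (v : TangentSpace I p) :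
    leviCivita I M (fun y => ∑ i ∈ s, a i y • F i y) p v =
      ∑ i ∈ s, (a i p • leviCivita I M (F i) p v + d% (a i) p v • F i p) := by
  classical
  have hc := (leviCivita I M).isCovariantDerivativeOnUniv
  induction s using Finset.induction_on with
  | empty =>
    have := hc.zero (x := p)
    simp only [Finset.sum_empty]
    exact congrArg (fun L => L v) this
  | insert i s hi h =>
    simp only [Finset.sum_insert hi]
    have h1 : MDiffAt (T% (a i • F i)) p := (ha i).smul_section (hF i)
    have h2 : MDiffAt (T% (fun y => ∑ i ∈ s, a i y • F i y)) p :=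
      .sum_section fun i _ => (ha i).smul_section (hF i)
    rw [← h]
    have e1 := hc.add h1 h2
    have e2 := hc.leibniz (hF i) (ha i)
    rw [e2] at e1
    have e3 := congrArg (fun L => L v) e1
    exact e3

/-- Torsion-freeness replaces [V, X] by ∇_V X - ∇_X V, and ∇_V ∇_X X drops out since ∇_X X vanishes
identically. -/
theorem IsGeodesicField.curvature_extend [Nontrivial E] (hX : IsGeodesicField X) {p : M}
    (v : TangentSpace I p) :
    curvature (extend E v) X X p =
      leviCivita I M X p (leviCivita I M (extend E v) p (X p))
        - leviCivita I M (fun y => leviCivita I M X y (extend E v y)) p (X p)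
        - leviCivita I M X p (leviCivita I M X p v) := by
  have h1 := leviCivita_sub_eq_mlieBracket (mdifferentiableAt_extend I E v) (hX.mdifferentiableAt p)
  have h2 : (fun y => leviCivita I M X y (X y)) = 0 := funext hX.geodesic
  rw [curvature, ← h1, h2, CovariantDerivative.zero]
  simp only [extend_apply_self, map_sub]
  simp
  abel

/-- The Riccati equation for the divergence of a geodesic field. -/
theorem IsGeodesicField.trace_riccati [Nontrivial E] (hX : IsGeodesicField X) (p : M) :
    MDiffAt (fun y : M => LinearMap.trace ℝ (TangentSpace I y)
      (leviCivita I M X y).toLinearMap) p ∧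
    d% (fun y : M => LinearMap.trace ℝ (TangentSpace I y)
      (leviCivita I M X y).toLinearMap) p (X p) =
      - ricci X p - LinearMap.trace ℝ (TangentSpace I p)
        ((leviCivita I M X p).toLinearMap ∘ₗ (leviCivita I M X p).toLinearMap) := by
  -- The frame F extending o need not be orthonormal away from p, so near p the trace is computed
  -- from frame coefficients; orthonormality is used only at p.
  let o := stdOrthonormalBasis ℝ (TangentSpace I p)
  let t := trivializationAt E (TangentSpace I) p
  have hp : p ∈ t.baseSet := FiberBundle.mem_baseSet_trivializationAt' p
  let b := o.toBasis.map (t.linearEquivAt ℝ p hp)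
  let F k : Π x : M, TangentSpace I x := extend E (o k)
  have hFp k : F k p = o k := extend_apply_self E (o k)
  have hFb k {y : M} (hy : y ∈ t.baseSet) : F k y = t.localFrame b k y := by
    rw [← extend_eq_localFrame hp hy o.toBasis k, o.coe_toBasis]
  have hF k : CMDiffAt ∞ (T% (F k)) p := contMDiffAt_extend I E _
  let Z k : Π x : M, TangentSpace I x := fun y => leviCivita I M X y (F k y)
  have hZ k : CMDiffAt ∞ (T% (Z k)) p := contMDiffAt_leviCivita (hX.smooth p) (hF k)
  let A j k : M → ℝ := fun y => t.localFrameCoeff I b j y (Z k y)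
  have hA j k : MDiffAt (A j k) p :=
    (contMDiffAt_localFrameCoeff (e := t) b hp (hZ k) j).mdifferentiableAt (by simp)
  have htr : (fun y : M => LinearMap.trace ℝ (TangentSpace I y)
      (leviCivita I M X y).toLinearMap) =ᶠ[nhds p] fun y => ∑ k, A k k y := by
    filter_upwards [t.open_baseSet.mem_nhds hp] with y hy
    rw [LinearMap.trace_eq_matrix_trace ℝ (t.basisAt b hy), Matrix.trace]
    refine Finset.sum_congr rfl fun k _ => ?_
    rw [Matrix.diag_apply, LinearMap.toMatrix_apply]
    refine Eq.trans ?_ (t.localFrameCoeff_apply_of_mem_baseSet (I := I) b hy (Z k) k).symm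
    simp only [Z, hFb _ hy, t.localFrame_apply_of_mem_baseSet b hy]
    rfl
  have hcov k (v : TangentSpace I p) : leviCivita I M (Z k) p v =
      ∑ j, (A j k p • leviCivita I M (F j) p v + d% (A j k) p v • F j p) := by
    have hev : ∀ᶠ y in nhds p, Z k y = ∑ j, A j k y • F j y := by
      filter_upwards [t.open_baseSet.mem_nhds hp] with y hy
      simp only [hFb _ hy]
      exact t.eq_sum_localFrameCoeff_smul hy
    have hFd j : MDiffAt (T% (F j)) p := (hF j).mdifferentiableAt (by simp)
    rw [(leviCivita I M).isCovariantDerivativeOnUniv.congr_of_eventuallyEq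
      ((hZ k).mdifferentiableAt (by simp))
      (.sum_section fun j _ => (hA j k).smul_section (hFd j)) Filter.univ_mem hev]
    exact leviCivita_sum_smul _ (fun j => hA j k) hFd v
  refine ⟨MDifferentiableAt.congr_of_eventuallyEq
    (mvfderiv_sum Finset.univ fun k => hA k k).1 htr, ?_⟩
  have hd : d% (fun y : M => LinearMap.trace ℝ (TangentSpace I y)
      (leviCivita I M X y).toLinearMap) p (X p) = ∑ k, d% (A k k) p (X p) := by
    rw [mvfderiv_congr htr, (mvfderiv_sum Finset.univ fun k => hA k k).2]
    simp
  let β := (leviCivita I M X p).toLinearMap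
  -- Γ records how the frame turns in the direction X. It enters the curvature only through the
  -- commutator of β and Γ, which has trace zero.
  let Γ : TangentSpace I p →ₗ[ℝ] TangentSpace I p :=
    o.toBasis.constr ℝ fun j => leviCivita I M (F j) p (X p)
  have hΓ j : Γ (o j) = leviCivita I M (F j) p (X p) := by
    simp only [Γ]
    rw [← o.coe_toBasis]
    exact Module.Basis.constr_basis _ _ _ _
  have hβ k : β (o k) = ∑ j, A j k p • o j := by
    have : Z k p = ∑ j, A j k p • t.localFrame b j p := t.eq_sum_localFrameCoeff_smul hp
    simp only [← hFb _ hp, hFp] at this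
    rw [← this]
    simp only [Z, hFp]
    rfl
  have hterm k : inner ℝ (curvature (extend E (o k)) X X p) (o k) =
      inner ℝ (o k) ((β ∘ₗ Γ) (o k)) - inner ℝ (o k) ((Γ ∘ₗ β) (o k)) - d% (A k k) p (X p)
        - inner ℝ (o k) ((β ∘ₗ β) (o k)) := by
    rw [hX.curvature_extend, inner_sub_left, inner_sub_left]
    have h1 : leviCivita I M (fun y => leviCivita I M X y (extend E (o k) y)) p (X p) =
        Γ (β (o k)) + ∑ j, d% (A j k) p (X p) • o j := by
      rw [hβ, map_sum, ← Finset.sum_add_distrib]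
      simp only [map_smul, hΓ]
      simpa only [hFp] using hcov k (X p)
    have h2 : inner ℝ (∑ j, d% (A j k) p (X p) • o j) (o k) = d% (A k k) p (X p) := by
      rw [real_inner_comm]
      exact o.orthonormal.inner_right_fintype _ k
    have h3 : leviCivita I M X p (leviCivita I M (extend E (o k)) p (X p)) = β (Γ (o k)) := by
      rw [hΓ]
      rfl
    have h4 : leviCivita I M X p (leviCivita I M X p (o k)) = β (β (o k)) := rfl
    rw [h1, h3, h4, inner_add_left, h2]
    simp only [LinearMap.comp_apply, real_inner_comm (o k)]
    ring
  have htrace (T : TangentSpace I p →ₗ[ℝ] TangentSpace I p) :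
      LinearMap.trace ℝ (TangentSpace I p) T = ∑ k, inner ℝ (o k) (T (o k)) :=
    LinearMap.trace_eq_sum_inner T o
  have hcomm := LinearMap.trace_mul_comm ℝ β Γ
  rw [Module.End.mul_eq_comp, Module.End.mul_eq_comp, htrace, htrace] at hcomm
  rw [hd, htrace, ricci, Finset.sum_congr rfl fun k _ => hterm k]
  simp only [Finset.sum_sub_distrib]
  rw [hcomm]
  ring

end Riccati

/-! ### Riccati inequalities on the whole line. -/

/-- Once negative, h decreases and stays negative, while (1/h)' = -h'/h² ≥ 1/2. So 1/h would have to
reach 0 in finite time, which is impossible. -/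
theorem nonneg_of_deriv_le_neg_sq {h h' : ℝ → ℝ} (hd : ∀ t, HasDerivAt h (h' t) t)
    (hle : ∀ t, h' t ≤ - (h t) ^ 2 / 2) (t₀ : ℝ) : 0 ≤ h t₀ := by
  by_contra! hneg
  have hanti : Antitone h := antitone_of_hasDerivAt_nonpos hd fun t => by
    show h' t ≤ 0
    linarith [hle t, sq_nonneg (h t)]
  have hlt : ∀ t ∈ Set.Ici t₀, h t < 0 := fun t ht => (hanti ht).trans_lt hneg
  have hg : ∀ t ∈ Set.Ici t₀,
      HasDerivAt (fun t => (h t)⁻¹ - t / 2) (- h' t / (h t) ^ 2 - 1 / 2) t := fun t ht =>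
    ((hd t).inv (hlt t ht).ne).sub ((hasDerivAt_id t).div_const 2)
  have hmono : MonotoneOn (fun t => (h t)⁻¹ - t / 2) (Set.Ici t₀) := by
    refine monotoneOn_of_hasDerivWithinAt_nonneg (f' := fun t => - h' t / (h t) ^ 2 - 1 / 2)
      (convex_Ici t₀)
      (fun t ht => (hg t ht).continuousAt.continuousWithinAt)
      (fun t ht => (hg t (interior_subset ht)).hasDerivWithinAt) fun t ht => ?_
    have hpos : 0 < (h t) ^ 2 := by
      have := hlt t (interior_subset ht)
      nlinarith
    rw [sub_nonneg, le_div_iff₀ hpos]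
    linarith [hle t]
  have hinv : (h t₀)⁻¹ < 0 := inv_lt_zero.2 hneg
  -- Growing at rate at least 1/2 from 1/h(t₀), the function 1/h is nonnegative by this time.
  have hmem : t₀ - 2 * (h t₀)⁻¹ ∈ Set.Ici t₀ := by
    simp only [Set.mem_Ici]; linarith
  have h1 := hmono (Set.self_mem_Ici) hmem hmem
  have h2 : (h (t₀ - 2 * (h t₀)⁻¹))⁻¹ < 0 := inv_lt_zero.2 (hlt _ hmem)
  simp only at h1
  linarith

/-- A solution of the Riccati inequality `h' ≤ -h² / 2` on all of `ℝ` vanishes. -/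
theorem eq_zero_of_deriv_le_neg_sq {h h' : ℝ → ℝ} (hd : ∀ t, HasDerivAt h (h' t) t)
    (hle : ∀ t, h' t ≤ - (h t) ^ 2 / 2) (t : ℝ) : h t = 0 := by
  refine le_antisymm ?_ (nonneg_of_deriv_le_neg_sq hd hle t)
  -- The inequality is invariant under replacing h(t) by -h(-t), which gives the opposite sign.
  have := nonneg_of_deriv_le_neg_sq (h := fun t => - h (-t)) (h' := fun t => h' (-t))
    (fun t => by
      have := ((hd (-t)).scomp t (hasDerivAt_neg t)).neg
      simp only [neg_smul, one_smul, neg_neg] at this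
      exact this)
    (fun t => by simpa using hle (-t)) (-t)
  simpa using this

/-! ### Traces and eigenvalues of symmetric endomorphisms. -/

section Symmetric

variable {V : Type*} [NormedAddCommGroup V] [InnerProductSpace ℝ V]
  {T : V →ₗ[ℝ] V}

theorem trace_comp_self_eq_sum (hT : T.IsSymmetric) {ι : Type*} [Fintype ι]
    (o : OrthonormalBasis ι ℝ V) :
    LinearMap.trace ℝ V (T ∘ₗ T) = ∑ i, ‖T (o i)‖ ^ 2 := by
  rw [LinearMap.trace_eq_sum_inner _ o]
  refine Finset.sum_congr rfl fun i _ => ?_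
  rw [LinearMap.comp_apply, ← hT, real_inner_self_eq_norm_sq]

variable [FiniteDimensional ℝ V]

theorem trace_comp_self_nonneg (hT : T.IsSymmetric) : 0 ≤ LinearMap.trace ℝ V (T ∘ₗ T) := by
  rw [trace_comp_self_eq_sum hT (stdOrthonormalBasis ℝ V)]
  positivity

theorem eq_zero_of_trace_comp_self_eq_zero (hT : T.IsSymmetric)
    (h : LinearMap.trace ℝ V (T ∘ₗ T) = 0) : T = 0 := by
  rw [trace_comp_self_eq_sum hT (stdOrthonormalBasis ℝ V),
    Finset.sum_eq_zero_iff_of_nonneg fun _ _ => by positivity] at h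
  refine (stdOrthonormalBasis ℝ V).toBasis.ext fun i => ?_
  simpa using h i (Finset.mem_univ i)

/-- Symmetry makes both eigenvalues real, and (λ - μ)²/2 = λ² + μ² - (λ + μ)²/2. -/
theorem exists_aroots_charpoly_eq_pair (hT : T.IsSymmetric) (hn : Module.finrank ℝ V = 2) :
    ∃ l m : ℂ, T.charpoly.aroots ℂ = {l, m} ∧
      ‖l - m‖ ^ 2 / 2 = LinearMap.trace ℝ V (T ∘ₗ T) - LinearMap.trace ℝ V T ^ 2 / 2 := by
  refine ⟨(hT.eigenvalues hn 0 : ℝ), (hT.eigenvalues hn 1 : ℝ), ?_, ?_⟩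
  · have h := hT.roots_charpoly_eq_eigenvalues hn
    rw [Polynomial.aroots, hT.splits_charpoly.roots_map, h]
    simp [Fin.univ_succ]
  · rw [trace_comp_self_eq_sum hT (hT.eigenvectorBasis hn), hT.trace_eq_sum_eigenvalues hn,
      ← Complex.ofReal_sub, Complex.norm_real, Real.norm_eq_abs, sq_abs]
    simp only [hT.apply_eigenvectorBasis, norm_smul, Fin.sum_univ_two]
    simp
    ring

end Symmetric

/-! ### From ∇X to β, and rigidity along complete curves. -/

section Beta

variable {E : Type*} [NormedAddCommGroup E] [NormedSpace ℝ E]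
  {H : Type*} [TopologicalSpace H] {I : ModelWithCorners ℝ E H}
  {M : Type*} [TopologicalSpace M] [ChartedSpace H M]
  [RiemannianBundle (fun x : M => TangentSpace I x)] [IsManifold I ∞ M]
  [IsContMDiffRiemannianBundle I ∞ E (fun x : M => TangentSpace I x)]
  [FiniteDimensional ℝ E] {X : Π x : M, TangentSpace I x}

/-- ∇X takes values in X^⊥, so it factors through the inclusion of X^⊥, and the trace is cyclic. -/
theorem trace_beta (hX : IsGeodesicField X) (p : M) :
    LinearMap.trace ℝ (TangentSpace I p) (leviCivita I M X p).toLinearMap =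
      LinearMap.trace ℝ _ (beta hX p) := by
  let L' : TangentSpace I p →ₗ[ℝ] (Submodule.span ℝ {X p})ᗮ :=
    (leviCivita I M X p).toLinearMap.codRestrict _ fun v =>
      Submodule.mem_orthogonal_singleton_iff_inner_right.2 (hX.inner_leviCivita_eq_zero p v)
  exact LinearMap.trace_comp_comm' L' (Submodule.subtype _)

theorem trace_beta_comp_self (hX : IsGeodesicField X) (p : M) :
    LinearMap.trace ℝ (TangentSpace I p)
        ((leviCivita I M X p).toLinearMap ∘ₗ (leviCivita I M X p).toLinearMap) =
      LinearMap.trace ℝ _ (beta hX p ∘ₗ beta hX p) := by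
  let L' : TangentSpace I p →ₗ[ℝ] (Submodule.span ℝ {X p})ᗮ :=
    (leviCivita I M X p).toLinearMap.codRestrict _ fun v =>
      Submodule.mem_orthogonal_singleton_iff_inner_right.2 (hX.inner_leviCivita_eq_zero p v)
  exact LinearMap.trace_comp_comm' (L' ∘ₗ (leviCivita I M X p).toLinearMap) (Submodule.subtype _)

theorem isSymmetric_beta (hX : IsGeodesicField X) {p : M}
    (h : ∀ v w, curlForm X p v w = 0) : (beta hX p).IsSymmetric := by
  intro v w
  have := h v w
  rw [curlForm, sub_eq_zero, real_inner_comm (v : TangentSpace I p)] at this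
  exact this

/-- Inserting X as first argument of α ∧ dα leaves dα(v, w), because α(X) = 1 and i_X dα = 0. -/
theorem curlForm_eq_zero_of_not_isContactAt (hX : IsGeodesicField X) {p : M}
    (h : ¬ IsContactAt X p) (v w : TangentSpace I p) : curlForm X p v w = 0 := by
  simp only [IsContactAt, not_exists, not_not] at h
  have := h (X p) v w
  have hα : dualForm X p (X p) = 1 := by
    change inner ℝ (X p) (X p) = (1 : ℝ)
    rw [real_inner_self_eq_norm_sq, hX.norm_eq_one, one_pow]
  simpa [wedgeExteriorDeriv, exteriorDeriv_dualForm (hX.mdifferentiableAt p), hα,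
    hX.curlForm_self_left, hX.curlForm_self_right] using this

theorem finrank_orthogonal (hX : IsGeodesicField X) (hE : Module.finrank ℝ E = 3) (p : M) :
    Module.finrank ℝ (Submodule.span ℝ {X p})ᗮ = 2 := by
  have : Fact (Module.finrank ℝ (TangentSpace I p) = 2 + 1) := ⟨hE⟩
  refine Submodule.finrank_orthogonal_span_singleton fun h => ?_
  have := hX.norm_eq_one p
  simp [h] at this

/-- If `∇X` is symmetric along an integral curve of `X` defined for all times and
`Ric(X) + |λ - μ|² / 2 ≥ 0`, then `Ric(X) = - tr β²` at each point of the curve. -/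
theorem ricci_eq_neg_trace [Nontrivial E] (hX : IsGeodesicField X)
    (hE : Module.finrank ℝ E = 3)
    (hric : ∀ p : M, ∀ l m : ℂ, IsEigenvaluePair hX p l m → 0 ≤ ricci X p + ‖l - m‖ ^ 2 / 2)
    {γ : ℝ → M} (hγ : IsMIntegralCurve γ X) (hsymm : ∀ t v w, curlForm X (γ t) v w = 0) (t : ℝ) :
    ricci X (γ t) = - LinearMap.trace ℝ _ (beta hX (γ t) ∘ₗ beta hX (γ t)) := by
  have hd t : HasDerivAt (fun t => LinearMap.trace ℝ (TangentSpace I (γ t))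
      (leviCivita I M X (γ t)).toLinearMap)
      (- ricci X (γ t) - LinearMap.trace ℝ _ (beta hX (γ t) ∘ₗ beta hX (γ t))) t := by
    have h := hX.trace_riccati (γ t)
    have := hasDerivAt_comp_integralCurve hγ h.1
    rwa [h.2, trace_beta_comp_self hX] at this
  -- With h = tr β, the Riccati right-hand side equals -(Ric + |λ - μ|²/2) - h²/2.
  have h0 := eq_zero_of_deriv_le_neg_sq hd fun t => by
    obtain ⟨l, m, hlm, hnorm⟩ := exists_aroots_charpoly_eq_pair (isSymmetric_beta hX (hsymm t))
      (finrank_orthogonal hX hE (γ t))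
    have := hric (γ t) l m hlm
    rw [trace_beta hX]
    linarith
  have h1 := hd t
  rw [funext h0] at h1
  have := h1.unique (hasDerivAt_const t 0)
  linarith

end Beta

end GeodesicField

end

theorem mainTheorem4 {M : Type*} [TopologicalSpace M] [T2Space M]
    [ChartedSpace (EuclideanSpace ℝ (Fin 3)) M] [IsManifold (𝓡 3) ∞ M]
    [RiemannianBundle (fun x : M => TangentSpace (𝓡 3) x)]
    [IsContMDiffRiemannianBundle (𝓡 3) ∞ (EuclideanSpace ℝ (Fin 3))
      (fun x : M => TangentSpace (𝓡 3) x)]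
    (X : Π x : M, TangentSpace (𝓡 3) x)
    (hX : GeodesicField.IsGeodesicField X) (hcomplete : GeodesicField.IsCompleteField X) :
    ((∀ p : M, ∀ l m : ℂ, GeodesicField.IsEigenvaluePair hX p l m →
        0 ≤ GeodesicField.ricci X p + ‖l - m‖ ^ 2 / 2) →
      ∀ p : M, ¬ GeodesicField.IsContactAt X p →
        GeodesicField.ricci X p < 0 ∨
          (GeodesicField.ricci X p = 0 ∧ GeodesicField.beta hX p = 0)) ∧
    ((∀ p : M, 0 ≤ GeodesicField.ricci X p) →
      (∀ p : M, GeodesicField.ricci X p = 0 → GeodesicField.beta hX p ≠ 0) →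
      GeodesicField.InducesContactStructure X) := by
  have key : (∀ p : M, ∀ l m : ℂ, GeodesicField.IsEigenvaluePair hX p l m →
        0 ≤ GeodesicField.ricci X p + ‖l - m‖ ^ 2 / 2) →
      ∀ p : M, ¬ GeodesicField.IsContactAt X p →
        GeodesicField.ricci X p < 0 ∨
          (GeodesicField.ricci X p = 0 ∧ GeodesicField.beta hX p = 0) := by
    intro hric p hp
    obtain ⟨γ, rfl, hγ⟩ := hcomplete p
    have h0 := GeodesicField.curlForm_eq_zero_of_not_isContactAt hX hp
    have hs := GeodesicField.isSymmetric_beta hX h0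
    have h1 := GeodesicField.ricci_eq_neg_trace hX (by simp) hric hγ
      (fun t v w => hX.curlForm_eq_zero_of_integralCurve hγ h0 t v w) 0
    rcases (GeodesicField.trace_comp_self_nonneg hs).lt_or_eq with h | h
    · left
      linarith
    · right
      exact ⟨by linarith, GeodesicField.eq_zero_of_trace_comp_self_eq_zero hs h.symm⟩
  refine ⟨key, fun hric hβ p => ?_⟩
  by_contra hp
  -- The eigenvalue term is nonnegative, so Ric(X) ≥ 0 alone gives the hypothesis of (a).
  rcases key (fun p l m _ => add_nonneg (hric p) (by positivity)) p hp with h | ⟨h, h'⟩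
  · exact absurd (hric p) (not_le.2 h)
  · exact hβ p h h'
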